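/- \textbf{Impossibility of asymmetric key cryptography without quantum memory.} \emph{Model.} A transmission is a finite sequence of rounds; in each round a register of finitely many qubits is sent. Within a round a party may perform any quantum operation, but a party \emph{without quantum memory} keeps only classical data between rounds and before and after a transmission. So a sender without quantum memory makes random classical choices and then sends one density matrix per round, and a receiver without quantum memory measures each incoming register completely (by a POVM that may depend on all earlier outcomes) and ends with a classical result. A \emph{0-qmemory asymmetric key encryption scheme} consists, for each security parameter $\lambda$, of: $\mathsf{Gen}(1^\lambda)$, which samples a classical private key $sk\in\{0,1\}^{p(\lambda)}$ with $p$ polynomially bounded; $\mathsf{KeySend}(sk)$, which sends a (classical, pure or mixed) quantum public key copy $\rho_{pk}$; $\mathsf{KeyReceive}(\rho_{pk})$, which extracts a classical key $k$ (a bit string) from it; $\mathsf{Enc}(k,\mu)$, which sends a quantum ciphertext for a message $\mu\in\mathcal M_\lambda$; and $\mathsf{Dec}(sk,\cdot)$, which receives a ciphertext and outputs a message; all of these run without quantum memory. In a \emph{0-qmemory signature scheme}, $\mathsf{Enc},\mathsf{Dec}$ are replaced by $\mathsf{Sign}(sk,\mu)$, which sends a quantum signature, and $\mathsf{Verify}(k,\mu,\cdot)$,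 which receives a signature and outputs a bit. A scheme is \emph{correct} if for all messages $\mu=\mu_\lambda$, when $sk\leftarrow\mathsf{Gen}(1^\lambda)$ and $k\leftarrow\mathsf{KeyReceive}(\mathsf{KeySend}(sk))$, one has $\mathsf{Dec}(sk,\mathsf{Enc}(k,\mu))=\mu$, respectively $\mathsf{Verify}(k,\mu,\mathsf{Sign}(sk,\mu))=1$, with probability at least $1-\mathrm{negl}(\lambda)$. No bound on the running time of the honest parties is assumed. Adversaries are computationally unbounded, have no quantum memory, and make at most polynomially many oracle queries, in particular any polynomial number of queries to $\mathsf{KeySend}(sk)$ (each giving a fresh public key copy); each oracle transmission is processed before the next query is made. In all experiments $sk$ is sampled by $\mathsf{Gen}(1^\lambda)$ and $k$ is extracted from one public key copy, hidden from the adversary. \textbf{Theorem.} There is no secure correct 0-qmemory asymmetric key scheme. Precisely: (1) Let $\Pi$ be a correct 0-qmemory asymmetric key encryption scheme with $|\mathcal M_\lambda|\ge 2$ for all $\lambda$. Then: (a) for all messages $\mu_0\ne\mu_1$ (families with $\mu_{0,\lambda}\neq\mu_{1,\lambda}$ for all $\lambda$), it is not the case that every adversary that has only public key copies and then gets $\mathsf{Enc}(k,\mu_b)$,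 for a uniform bit $b$, guesses $b$ with probability at most $\frac12+\mathrm{negl}(\lambda)$; (b) $\Pi$ is not qDCCA1-secure: it is not the case that every adversary that, with access to $\mathsf{KeySend}(sk)$, $\mathsf{Enc}(k,\cdot)$, $\mathsf{Dec}(sk,\cdot)$, chooses two messages $m_0,m_1$, then receives $\mathsf{Enc}(k,m_b)$ and afterwards $sk$, and from then on has access to $\mathsf{KeySend}(sk)$, $\mathsf{Enc}(k,\cdot)$ only, guesses $b$ with probability at most $\frac12+\mathrm{negl}(\lambda)$; (c) $\Pi$ is not qUCCA-secure: it is not the case that for every adversary that chooses $m_0,m_1$ as in (b) and, while receiving $\mathsf{Enc}(k,m_b)$, feeds quantum and classical information to two isolated parties without quantum memory who know $sk$ (and at the end, after further queries to $\mathsf{KeySend}(sk)$ and $\mathsf{Enc}(k,\cdot)$, a last classical message), both of these output $b$ with probability at most $\frac12+\mathrm{negl}(\lambda)$. (2) Let $\Pi$ be a correct 0-qmemory signature scheme with $\mathcal M_\lambda\ne\emptyset$ for all $\lambda$. Then: (a) for every (family of) messages $\mu$, it is not the case that every adversary that has only public key copies produces a transmission accepted by $\mathsf{Verify}(k,\mu,\cdot)$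 with probability at most $\mathrm{negl}(\lambda)$; (b) $\Pi$ is not qDCMVA-secure: it is not the case that every adversary that first has access to $\mathsf{KeySend}(sk)$, $\mathsf{Sign}(sk,\cdot)$, $\mathsf{Verify}(k,\cdot)$, and then to $\mathsf{KeySend}(sk)$, $\mathsf{Verify}(k,\cdot)$ only, outputs a message and a signature accepted by $\mathsf{Verify}(k,\cdot)$ with probability at most $\mathrm{negl}(\lambda)$; (c) $\Pi$ is not qUCVA-secure: it is not the case that every adversary with access to $\mathsf{KeySend}(sk)$, $\mathsf{Verify}(k,\cdot)$ and at most one query to $\mathsf{Sign}(sk,\cdot)$ outputs two pairs of a message and a signature that are both accepted with probability at most $\mathrm{negl}(\lambda)$. -/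

import Mathlib

open scoped Matrix Kronecker ComplexOrder MatrixOrder

/-! ### Asymptotics -/

/-- Negligible functions of the security parameter: eventually smaller than the inverse of
every polynomial. -/
def Negligible (ν : ℕ → ℝ) : Prop :=
  Asymptotics.SuperpolynomialDecay Filter.atTop (fun n : ℕ => (n : ℝ)) ν

def PolyBounded (t : ℕ → ℕ) : Prop :=
  ∃ P : Polynomial ℕ, ∀ n, t n ≤ P.eval n

/-! ### States and measurements of a register of `d` qubits -/

/-- Labels of the computational basis of `d` qubits. -/
abbrev Qubits (d : ℕ) : Type := Fin d → Bool

/-- Density matrices of `d` qubits (pure, mixed, or classical, i.e. diagonal). -/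
structure Density (d : ℕ) where
  mat : Matrix (Qubits d) (Qubits d) ℂ
  posSemidef : mat.PosSemidef
  trace_eq_one : mat.trace = 1

/-- Measurements of `d` qubits with classical outcomes in `ι`. -/
structure POVM (d : ℕ) (ι : Type) [Fintype ι] where
  effect : ι → Matrix (Qubits d) (Qubits d) ℂ
  posSemidef : ∀ i, (effect i).PosSemidef
  sum_eq_one : ∑ i, effect i = 1

theorem trace_mul_re_nonneg {d : ℕ} {E ρ : Matrix (Qubits d) (Qubits d) ℂ}
    (hE : E.PosSemidef) (hρ : ρ.PosSemidef) : 0 ≤ (E * ρ).trace.re := by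
  obtain ⟨B, rfl⟩ := CStarAlgebra.nonneg_iff_eq_star_mul_self.1 hE.nonneg
  rw [Matrix.star_eq_conjTranspose]
  have h : (Bᴴ * B * ρ).trace = (B * ρ * Bᴴ).trace := by
    rw [Matrix.mul_assoc, Matrix.trace_mul_comm]
  rw [h]
  exact (Complex.le_def.1 (hρ.mul_mul_conjTranspose_same B).trace_nonneg).1

theorem born_sum {d : ℕ} {ι : Type} [Fintype ι] (E : POVM d ι) (ρ : Density d) :
    ∑ i, ENNReal.ofReal ((E.effect i * ρ.mat).trace.re) = 1 := by
  rw [← ENNReal.ofReal_sum_of_nonneg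
    (fun i _ => trace_mul_re_nonneg (E.posSemidef i) ρ.posSemidef), ← Complex.re_sum,
    ← Matrix.trace_sum, ← Finset.sum_mul, E.sum_eq_one, Matrix.one_mul, ρ.trace_eq_one]
  simp

/-- The law of the outcome of a measurement (Born rule): outcome `i` has probability
`tr (Eᵢ ρ)`. -/
noncomputable def POVM.measure {d : ℕ} {ι : Type} [Fintype ι] (E : POVM d ι) (ρ : Density d) :
    PMF ι :=
  PMF.ofFintype (fun i => ENNReal.ofReal ((E.effect i * ρ.mat).trace.re)) (born_sum E ρ)

/-! ### Transmissions between parties without quantum memory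

A transmission is a sequence of rounds. Its format is the list of the numbers of qubits sent in
the rounds. Within a round a party may perform any quantum operation; between two rounds, and
before and after the transmission, a party without quantum memory keeps classical data only. -/

/-- What is sent in a transmission of format `ds` once the classical random choices of the sender
are fixed: one state for each round. A sender without quantum memory cannot entangle the rounds, so
its transmission is a random element of this type, i.e. a `PMF (Signal ds)`. -/
def Signal : List ℕ → Type
  | [] => Unit
  | d :: ds => Density d × Signal ds

/-- A receiver without quantum memory, with a classical result in `α`: in every round it measures
the whole incoming register; the measurement may depend on all previous outcomes. After the last
round it outputs a (possibly random) result. -/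
def Receiver (α : Type) : List ℕ → Type
  | [] => PMF α
  | d :: ds => Σ m : ℕ, POVM d (Fin m) × (Fin m → Receiver α ds)

/-- The law of the result of a receiver. -/
noncomputable def Receiver.run {α : Type} : {ds : List ℕ} → Receiver α ds → Signal ds → PMF α
  | [], R, _ => R
  | _ :: _, ⟨_, E, next⟩, (ρ, σ) => (E.measure ρ).bind fun i => (next i).run σ

/-! ### Oracle programs: parties with classical memory and unlimited computing power

There is no restriction on the computing power, only a count of the queries. A transmission that
an oracle sends is processed to its end before the next query; this keeps the class of adversaries
small, so that security against it asks for less. -/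

/-- Randomized adaptive programs that ask oracle queries `q : Q`, answered in `A q`. -/
inductive Prog (Q : Type) (A : Q → Type) (α : Type) : Type
  | ret (a : α) : Prog Q A α
  | coin (p : PMF ℕ) (next : ℕ → Prog Q A α) : Prog Q A α
  | ask (q : Q) (next : A q → Prog Q A α) : Prog Q A α

noncomputable def Prog.eval {Q : Type} {A : Q → Type} {α : Type} (oracle : ∀ q, PMF (A q)) :
    Prog Q A α → PMF α
  | .ret a => PMF.pure a
  | .coin p next => p.bind fun i => (next i).eval oracle
  | .ask q next => (oracle q).bind fun a => (next a).eval oracle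

/-- On every execution path the total weight of the queries is at most `t`, where the query `q`
has the weight `w q`. -/
def Prog.CostLE {Q : Type} {A : Q → Type} {α : Type} (w : Q → ℕ) : Prog Q A α → ℕ → Prop
  | .ret _, _ => True
  | .coin _ next, t => ∀ i, (next i).CostLE w t
  | .ask q next, t => w q ≤ t ∧ ∀ a, (next a).CostLE w (t - w q)

/-- The classical memory of an adversary. -/
abbrev Bits : Type := List Bool

noncomputable def fairCoin : PMF Bool := PMF.uniformOfFintype Bool

/-! ### Splitting a transmission into two pieces -/

/-- A quantum instrument from `d` qubits to two registers of `d₁` and `d₂` qubits, with classical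
outcomes in `Fin m`; the Kraus operators of the outcome `j` are `kraus j k`. -/
structure SplitOp (d d₁ d₂ m r : ℕ) where
  kraus : Fin m → Fin r → Matrix (Qubits d₁ × Qubits d₂) (Qubits d) ℂ
  sum_eq_one : ∑ j, ∑ k, (kraus j k)ᴴ * kraus j k = 1

/-- Apply the instrument, then measure the two output registers separately; this is a measurement
of the input register. -/
noncomputable def SplitOp.join {d d₁ d₂ m r m₁ m₂ : ℕ} (K : SplitOp d d₁ d₂ m r)
    (E₁ : POVM d₁ (Fin m₁)) (E₂ : POVM d₂ (Fin m₂)) : POVM d (Fin m × Fin m₁ × Fin m₂) where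
  effect x := ∑ k, (K.kraus x.1 k)ᴴ * (E₁.effect x.2.1 ⊗ₖ E₂.effect x.2.2) * K.kraus x.1 k
  posSemidef x := Matrix.posSemidef_sum _ fun _ _ =>
    ((E₁.posSemidef _).kronecker (E₂.posSemidef _)).conjTranspose_mul_mul_same _
  sum_eq_one := by
    have h : ∑ a, ∑ b, E₁.effect a ⊗ₖ E₂.effect b = 1 := by
      rw [← Matrix.one_kronecker_one, ← E₁.sum_eq_one, ← E₂.sum_eq_one]
      ext i j
      simp [Matrix.sum_apply, Matrix.kroneckerMap_apply, Finset.sum_mul_sum]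
    rw [Fintype.sum_prod_type, ← K.sum_eq_one]
    refine Finset.sum_congr rfl fun j _ => ?_
    rw [Finset.sum_comm]
    refine Finset.sum_congr rfl fun k _ => ?_
    dsimp only
    rw [← Matrix.sum_mul, ← Matrix.mul_sum, Fintype.sum_prod_type, h, Matrix.mul_one]

/-- A party without quantum memory that, while it receives a transmission, feeds registers of
`f₁` and `f₂` qubits to two other parties in every round. -/
def Splitter (α : Type) (f₁ f₂ : ℕ) : List ℕ → Type
  | [] => α
  | d :: ds => Σ m : ℕ, Σ r : ℕ, SplitOp d f₁ f₂ m r × (Fin m → Splitter α f₁ f₂ ds)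

/-- The joint law of the results of a splitter and of the two isolated parties it feeds. -/
noncomputable def Splitter.run {α β γ : Type} {f₁ f₂ : ℕ} : {ds : List ℕ} →
    Splitter α f₁ f₂ ds → Receiver β (ds.map fun _ => f₁) → Receiver γ (ds.map fun _ => f₂) →
    Signal ds → PMF (α × β × γ)
  | [], a, R₁, R₂, _ =>
      (show PMF β from R₁).bind fun b => (show PMF γ from R₂).map fun c => (a, b, c)
  | _ :: _, ⟨_, _, K, next⟩, ⟨_, E₁, next₁⟩, ⟨_, E₂, next₂⟩, (ρ, σ) =>
      ((K.join E₁ E₂).measure ρ).bind fun x =>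
        (next x.1).run (next₁ x.2.1) (next₂ x.2.2) σ

/-! ### Asymmetric key encryption without quantum memory -/

/-- An asymmetric key encryption scheme, with quantum public keys and quantum ciphertexts, in
which no honest party needs quantum memory. `Msg n` is the message space for the security
parameter `n`. Everything an honest party keeps is classical: the private key, a bit string of
polynomial length, and the key extracted from a copy of the public key, a bit string. -/
structure EncScheme (Msg : ℕ → Type) where
  skLen : ℕ → ℕ
  skLen_poly : PolyBounded skLen
  keyLen : ℕ → ℕ
  pkFmt : ℕ → List ℕ
  ctFmt : ℕ → List ℕ
  gen : ∀ n, PMF (Fin (skLen n) → Bool)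
  keySend : ∀ n, (Fin (skLen n) → Bool) → PMF (Signal (pkFmt n))
  keyReceive : ∀ n, Receiver (Fin (keyLen n) → Bool) (pkFmt n)
  enc : ∀ n, (Fin (keyLen n) → Bool) → Msg n → PMF (Signal (ctFmt n))
  dec : ∀ n, (Fin (skLen n) → Bool) → Receiver (Msg n) (ctFmt n)

namespace EncScheme

variable {Msg : ℕ → Type}

abbrev SK (S : EncScheme Msg) (n : ℕ) : Type := Fin (S.skLen n) → Bool

abbrev Key (S : EncScheme Msg) (n : ℕ) : Type := Fin (S.keyLen n) → Bool

/-- A private key and a key extracted by an honest user from one copy of the public key. -/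
noncomputable def setup (S : EncScheme Msg) (n : ℕ) : PMF (S.SK n × S.Key n) := do
  let sk ← S.gen n
  let ρ ← S.keySend n sk
  let k ← (S.keyReceive n).run ρ
  return (sk, k)

noncomputable def decryption (S : EncScheme Msg) (n : ℕ) (μ : Msg n) : PMF (Msg n) := do
  let (sk, k) ← S.setup n
  let ρ ← S.enc n k μ
  (S.dec n sk).run ρ

def Correct (S : EncScheme Msg) : Prop :=
  ∀ μ : ∀ n, Msg n, ∃ ν, Negligible ν ∧ ∀ n, 1 - ν n ≤ (S.decryption n (μ n) (μ n)).toReal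

/-- Oracle queries: a fresh copy of the public key, processed without quantum memory; an
encryption of a chosen message, processed likewise; a decryption of a chosen transmission. -/
inductive Query (S : EncScheme Msg) (n : ℕ) : Type
  | key (R : Receiver Bits (S.pkFmt n))
  | enc (μ : Msg n) (R : Receiver Bits (S.ctFmt n))
  | dec (ρ : Signal (S.ctFmt n))

def Answer (S : EncScheme Msg) (n : ℕ) : S.Query n → Type
  | .key _ => Bits
  | .enc _ _ => Bits
  | .dec _ => Msg n

noncomputable def oracle (S : EncScheme Msg) (n : ℕ) (sk : S.SK n) (k : S.Key n) :
    ∀ q : S.Query n, PMF (S.Answer n q)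
  | .key R => (S.keySend n sk).bind fun ρ => R.run ρ
  | .enc μ R => (S.enc n k μ).bind fun ρ => R.run ρ
  | .dec ρ => (S.dec n sk).run ρ

def decWeight (S : EncScheme Msg) (n : ℕ) : S.Query n → ℕ
  | .dec _ => 1
  | _ => 0

def nonKeyWeight (S : EncScheme Msg) (n : ℕ) : S.Query n → ℕ
  | .key _ => 0
  | _ => 1

abbrev Attack (S : EncScheme Msg) (n : ℕ) (α : Type) : Type := Prog (S.Query n) (S.Answer n) α

/-! #### Indistinguishability of two given messages under a key-only attack -/

/-- The adversary sees copies of the public key, then processes the challenge ciphertext and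
guesses which of the two messages it encrypts. -/
noncomputable def keyOnlyExp (S : EncScheme Msg) (n : ℕ) (μ₀ μ₁ : Msg n)
    (adv : S.Attack n (Receiver Bool (S.ctFmt n))) : PMF Bool := do
  let (sk, k) ← S.setup n
  let b ← fairCoin
  let R ← adv.eval (S.oracle n sk k)
  let ρ ← S.enc n k (if b then μ₁ else μ₀)
  let b' ← R.run ρ
  return b' == b

/-- Security of two given (families of) messages against adversaries without quantum memory that
get polynomially many copies of the public key and nothing else. -/
def KeyOnlyIndist (S : EncScheme Msg) (μ₀ μ₁ : ∀ n, Msg n) : Prop :=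
  ∀ adv : ∀ n, S.Attack n (Receiver Bool (S.ctFmt n)),
    (∃ t, PolyBounded t ∧ ∀ n, (adv n).CostLE (fun _ => 1) (t n)) →
    (∀ n, (adv n).CostLE (S.nonKeyWeight n) 0) →
    ∃ ν, Negligible ν ∧
      ∀ n, (S.keyOnlyExp n (μ₀ n) (μ₁ n) (adv n) true).toReal ≤ 1 / 2 + ν n

/-! #### Disappearing indistinguishability under chosen ciphertext attacks -/

/-- `choose` selects two messages and the way in which the challenge ciphertext is going to be
processed; `guess` gets the classical data extracted from the ciphertext, and the private key. -/
structure DisAdversary (S : EncScheme Msg) where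
  choose : ∀ n, S.Attack n (Msg n × Msg n × Receiver Bits (S.ctFmt n))
  guess : ∀ n, Bits → S.SK n → S.Attack n Bool

/-- Polynomially many queries, and no decryption query after the challenge. -/
def DisAdversary.Admissible {S : EncScheme Msg} (adv : S.DisAdversary) : Prop :=
  ∃ t, PolyBounded t ∧ ∀ n, (adv.choose n).CostLE (fun _ => 1) (t n) ∧
    ∀ x sk, (adv.guess n x sk).CostLE (fun _ => 1) (t n) ∧
      (adv.guess n x sk).CostLE (S.decWeight n) 0

noncomputable def disExp (S : EncScheme Msg) (adv : S.DisAdversary) (n : ℕ) : PMF Bool := do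
  let (sk, k) ← S.setup n
  let b ← fairCoin
  let (m₀, m₁, R) ← (adv.choose n).eval (S.oracle n sk k)
  let ρ ← S.enc n k (if b then m₁ else m₀)
  let x ← R.run ρ
  let b' ← (adv.guess n x sk).eval (S.oracle n sk k)
  return b' == b

/-- qDCCA1 security against adversaries without quantum memory. -/
def QDCCA1 (S : EncScheme Msg) : Prop :=
  ∀ adv : S.DisAdversary, adv.Admissible →
    ∃ ν, Negligible ν ∧ ∀ n, (S.disExp adv n true).toReal ≤ 1 / 2 + ν n

/-! #### Unclonable security under chosen ciphertext attacks -/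

/-- `choose` selects two messages and the way in which the challenge ciphertext is split. The two
isolated parties `fst` and `snd` know the private key and are fed registers of `f₁ n` and `f₂ n`
qubits in every round. In the end `finish` sends each of them a classical message, and each of
them outputs a guess. -/
structure UncAdversary (S : EncScheme Msg) where
  f₁ : ℕ → ℕ
  f₂ : ℕ → ℕ
  choose : ∀ n, S.Attack n (Msg n × Msg n × Splitter Bits (f₁ n) (f₂ n) (S.ctFmt n))
  finish : ∀ n, Bits → S.Attack n (Bits × Bits)
  fst : ∀ n, S.SK n → Receiver (Bits → PMF Bool) ((S.ctFmt n).map fun _ => f₁ n)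
  snd : ∀ n, S.SK n → Receiver (Bits → PMF Bool) ((S.ctFmt n).map fun _ => f₂ n)

/-- Polynomially many queries, and no decryption query after the challenge. -/
def UncAdversary.Admissible {S : EncScheme Msg} (adv : S.UncAdversary) : Prop :=
  ∃ t, PolyBounded t ∧ ∀ n, (adv.choose n).CostLE (fun _ => 1) (t n) ∧
    ∀ x, (adv.finish n x).CostLE (fun _ => 1) (t n) ∧
      (adv.finish n x).CostLE (S.decWeight n) 0

noncomputable def uncExp (S : EncScheme Msg) (adv : S.UncAdversary) (n : ℕ) : PMF Bool := do
  let (sk, k) ← S.setup n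
  let b ← fairCoin
  let (m₀, m₁, T) ← (adv.choose n).eval (S.oracle n sk k)
  let ρ ← S.enc n k (if b then m₁ else m₀)
  let (x, g₁, g₂) ← T.run (adv.fst n sk) (adv.snd n sk) ρ
  let (y₁, y₂) ← (adv.finish n x).eval (S.oracle n sk k)
  let b₁ ← g₁ y₁
  let b₂ ← g₂ y₂
  return b₁ == b && b₂ == b

/-- qUCCA security against adversaries without quantum memory. -/
def QUCCA (S : EncScheme Msg) : Prop :=
  ∀ adv : S.UncAdversary, adv.Admissible →
    ∃ ν, Negligible ν ∧ ∀ n, (S.uncExp adv n true).toReal ≤ 1 / 2 + ν n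

end EncScheme

/-! ### Signatures without quantum memory -/

/-- A signature scheme, with quantum public keys and quantum signatures, in which no honest party
needs quantum memory. -/
structure SigScheme (Msg : ℕ → Type) where
  skLen : ℕ → ℕ
  skLen_poly : PolyBounded skLen
  keyLen : ℕ → ℕ
  pkFmt : ℕ → List ℕ
  sigFmt : ℕ → List ℕ
  gen : ∀ n, PMF (Fin (skLen n) → Bool)
  keySend : ∀ n, (Fin (skLen n) → Bool) → PMF (Signal (pkFmt n))
  keyReceive : ∀ n, Receiver (Fin (keyLen n) → Bool) (pkFmt n)
  sign : ∀ n, (Fin (skLen n) → Bool) → Msg n → PMF (Signal (sigFmt n))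
  verify : ∀ n, (Fin (keyLen n) → Bool) → Msg n → Receiver Bool (sigFmt n)

namespace SigScheme

variable {Msg : ℕ → Type}

abbrev SK (S : SigScheme Msg) (n : ℕ) : Type := Fin (S.skLen n) → Bool

abbrev Key (S : SigScheme Msg) (n : ℕ) : Type := Fin (S.keyLen n) → Bool

/-- A private key and a key extracted by an honest user from one copy of the public key. -/
noncomputable def setup (S : SigScheme Msg) (n : ℕ) : PMF (S.SK n × S.Key n) := do
  let sk ← S.gen n
  let ρ ← S.keySend n sk
  let k ← (S.keyReceive n).run ρ
  return (sk, k)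

noncomputable def verification (S : SigScheme Msg) (n : ℕ) (μ : Msg n) : PMF Bool := do
  let (sk, k) ← S.setup n
  let ρ ← S.sign n sk μ
  (S.verify n k μ).run ρ

def Correct (S : SigScheme Msg) : Prop :=
  ∀ μ : ∀ n, Msg n, ∃ ν, Negligible ν ∧ ∀ n, 1 - ν n ≤ (S.verification n (μ n) true).toReal

/-- Oracle queries: a fresh copy of the public key, processed without quantum memory; a signature
of a chosen message, processed likewise; the verification of a chosen message and transmission. -/
inductive Query (S : SigScheme Msg) (n : ℕ) : Type
  | key (R : Receiver Bits (S.pkFmt n))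
  | sign (μ : Msg n) (R : Receiver Bits (S.sigFmt n))
  | verify (μ : Msg n) (ρ : Signal (S.sigFmt n))

def Answer (S : SigScheme Msg) (n : ℕ) : S.Query n → Type
  | .key _ => Bits
  | .sign _ _ => Bits
  | .verify _ _ => Bool

noncomputable def oracle (S : SigScheme Msg) (n : ℕ) (sk : S.SK n) (k : S.Key n) :
    ∀ q : S.Query n, PMF (S.Answer n q)
  | .key R => (S.keySend n sk).bind fun ρ => R.run ρ
  | .sign μ R => (S.sign n sk μ).bind fun ρ => R.run ρ
  | .verify μ ρ => (S.verify n k μ).run ρ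

def signWeight (S : SigScheme Msg) (n : ℕ) : S.Query n → ℕ
  | .sign _ _ => 1
  | _ => 0

def nonKeyWeight (S : SigScheme Msg) (n : ℕ) : S.Query n → ℕ
  | .key _ => 0
  | _ => 1

abbrev Attack (S : SigScheme Msg) (n : ℕ) (α : Type) : Type := Prog (S.Query n) (S.Answer n) α

/-! #### Unforgeability of a given message under a key-only attack -/

noncomputable def keyOnlyExp (S : SigScheme Msg) (n : ℕ) (μ : Msg n)
    (adv : S.Attack n (Signal (S.sigFmt n))) : PMF Bool := do
  let (sk, k) ← S.setup n
  let ρ ← adv.eval (S.oracle n sk k)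
  (S.verify n k μ).run ρ

/-- No adversary without quantum memory that gets polynomially many copies of the public key, and
nothing else, can forge a signature of the given (family of) messages. -/
def KeyOnlyUnforgeable (S : SigScheme Msg) (μ : ∀ n, Msg n) : Prop :=
  ∀ adv : ∀ n, S.Attack n (Signal (S.sigFmt n)),
    (∃ t, PolyBounded t ∧ ∀ n, (adv n).CostLE (fun _ => 1) (t n)) →
    (∀ n, (adv n).CostLE (S.nonKeyWeight n) 0) →
    ∃ ν, Negligible ν ∧ ∀ n, (S.keyOnlyExp n (μ n) (adv n) true).toReal ≤ ν n

/-! #### Disappearing security under chosen message and verification attacks -/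

/-- `learn` may use all oracles; `forge` may not ask for signatures. -/
structure DisAdversary (S : SigScheme Msg) where
  learn : ∀ n, S.Attack n Bits
  forge : ∀ n, Bits → S.Attack n (Msg n × Signal (S.sigFmt n))

def DisAdversary.Admissible {S : SigScheme Msg} (adv : S.DisAdversary) : Prop :=
  ∃ t, PolyBounded t ∧ ∀ n, (adv.learn n).CostLE (fun _ => 1) (t n) ∧
    ∀ x, (adv.forge n x).CostLE (fun _ => 1) (t n) ∧
      (adv.forge n x).CostLE (S.signWeight n) 0

noncomputable def disExp (S : SigScheme Msg) (adv : S.DisAdversary) (n : ℕ) : PMF Bool := do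
  let (sk, k) ← S.setup n
  let x ← (adv.learn n).eval (S.oracle n sk k)
  let (μ, ρ) ← (adv.forge n x).eval (S.oracle n sk k)
  (S.verify n k μ).run ρ

/-- qDCMVA security against adversaries without quantum memory. -/
def QDCMVA (S : SigScheme Msg) : Prop :=
  ∀ adv : S.DisAdversary, adv.Admissible →
    ∃ ν, Negligible ν ∧ ∀ n, (S.disExp adv n true).toReal ≤ ν n

/-! #### Unclonable security under chosen verification attacks -/

/-- An adversary that outputs two signed messages. -/
abbrev UncAdversary (S : SigScheme Msg) : Type :=
  ∀ n, S.Attack n ((Msg n × Signal (S.sigFmt n)) × (Msg n × Signal (S.sigFmt n)))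

/-- Polynomially many queries, among them at most one signature query. -/
def UncAdmissible {S : SigScheme Msg} (adv : S.UncAdversary) : Prop :=
  ∃ t, PolyBounded t ∧ ∀ n, (adv n).CostLE (fun _ => 1) (t n) ∧
    (adv n).CostLE (S.signWeight n) 1

noncomputable def uncExp (S : SigScheme Msg) (adv : S.UncAdversary) (n : ℕ) : PMF Bool := do
  let (sk, k) ← S.setup n
  let ((μ, ρ), (μ', ρ')) ← (adv n).eval (S.oracle n sk k)
  let v ← (S.verify n k μ).run ρ
  let v' ← (S.verify n k μ').run ρ'
  return v && v'

/-- qUCVA security against adversaries without quantum memory. -/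
def QUCVA (S : SigScheme Msg) : Prop :=
  ∀ adv : S.UncAdversary, UncAdmissible adv →
    ∃ ν, Negligible ν ∧ ∀ n, (S.uncExp adv n true).toReal ≤ ν n

end SigScheme

/-! Without quantum memory an adversary can turn a copy of the public key into a classical key
exactly like the honest user, so the situation is classical: a substitute for the private key `sk`
can be learned from independent keys `k` of the same law as the hidden one. The learner takes a
candidate that maximises the likelihood `∏ k, s_k` of successful trials, where `s_k` is the success
probability of the trial of the candidate on `k`. By the Weierstrass product inequality
`∏ k, s_k ≥ 1 - ∑ k, (1 - s_k)`, correctness makes the likelihood of `sk` close to `1` on average,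
while a candidate that fails on the law of `k` with probability above `ε` has expected likelihood
at most `(1 - ε) ^ T` after `T` samples. A union bound over the `2 ^ p` candidates shows that `T`
linear in `p` suffices for the learned key to decrypt or sign almost as well as `sk`. -/

/-! ### Expectations under a discrete law -/

section Expectation

variable {α β : Type*}

/-- The expectation of a `[0, ∞]`-valued function under a discrete law. It needs no summability
side conditions, so failure probabilities can be averaged freely. -/
noncomputable def expect (p : PMF α) (f : α → ENNReal) : ENNReal := ∑' a, p a * f a

theorem bind_apply_eq_expect (p : PMF α) (f : α → PMF β) (b : β) :
    p.bind f b = expect p fun a => f a b := rfl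

theorem expect_pure (a : α) (f : α → ENNReal) : expect (PMF.pure a) f = f a := by
  rw [expect, tsum_eq_single a fun b hb => by rw [PMF.pure_apply_of_ne _ _ hb, zero_mul],
    PMF.pure_apply_self, one_mul]

theorem expect_bind (p : PMF α) (q : α → PMF β) (f : β → ENNReal) :
    expect (p.bind q) f = expect p fun a => expect (q a) f := by
  simp only [expect, PMF.bind_apply, ← ENNReal.tsum_mul_left, ← ENNReal.tsum_mul_right]
  rw [ENNReal.tsum_comm]
  simp only [mul_assoc]

theorem expect_map (p : PMF α) (g : α → β) (f : β → ENNReal) :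
    expect (p.map g) f = expect p fun a => f (g a) := by
  simp only [PMF.map, expect_bind, Function.comp_apply, expect_pure]

@[gcongr]
theorem expect_mono (p : PMF α) {f g : α → ENNReal} (h : ∀ a, f a ≤ g a) :
    expect p f ≤ expect p g :=
  ENNReal.tsum_le_tsum fun a => by gcongr; exact h a

theorem expect_const (p : PMF α) (c : ENNReal) : (expect p fun _ => c) = c := by
  rw [expect, ENNReal.tsum_mul_right, p.tsum_coe, one_mul]

theorem expect_add (p : PMF α) (f g : α → ENNReal) :
    (expect p fun a => f a + g a) = expect p f + expect p g := by
  simp only [expect, mul_add, ENNReal.tsum_add]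

theorem expect_const_mul (p : PMF α) (c : ENNReal) (f : α → ENNReal) :
    (expect p fun a => c * f a) = c * expect p f := by
  simp only [expect, mul_left_comm _ c, ENNReal.tsum_mul_left]

theorem expect_finset_sum {ι : Type*} (p : PMF α) (s : Finset ι) (f : ι → α → ENNReal) :
    (expect p fun a => ∑ i ∈ s, f i a) = ∑ i ∈ s, expect p (f i) := by
  simp only [expect, Finset.mul_sum]
  exact Summable.tsum_finsetSum fun _ _ => ENNReal.summable

theorem expect_fairCoin (f : Bool → ENNReal) : 2 * expect fairCoin f = f true + f false := by
  simp only [expect, fairCoin, PMF.uniformOfFintype_apply, tsum_fintype, Fintype.sum_bool,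
    Fintype.card_bool, Nat.cast_ofNat, ← mul_add]
  rw [ENNReal.mul_inv_cancel_left two_ne_zero ENNReal.ofNat_ne_top]

end Expectation

section Laws

variable {α β : Type*}

theorem apply_true_add_apply_false (p : PMF Bool) : p true + p false = 1 := by
  simpa only [tsum_fintype, Fintype.sum_bool] using p.tsum_coe

theorem apply_add_apply_le_one (p : PMF α) {a b : α} (h : a ≠ b) : p a + p b ≤ 1 := by
  classical
  rw [← Finset.sum_pair h, ← p.tsum_coe]
  exact ENNReal.sum_le_tsum _

theorem toReal_apply_true (p : PMF Bool) : (p true).toReal = 1 - (p false).toReal := by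
  rw [eq_sub_iff_add_eq, ← ENNReal.toReal_add (p.apply_ne_top _) (p.apply_ne_top _),
    apply_true_add_apply_false, ENNReal.toReal_one]

theorem map_beq_apply_false (p : PMF Bool) (b : Bool) : p.map (· == b) false = p (!b) := by
  cases b <;> simp [PMF.map_apply, tsum_fintype]

theorem bind_and_bind_false_le (p q : PMF Bool) :
    (p.bind fun a => q.bind fun b => PMF.pure (a && b)) false ≤ p false + q false := by
  have h : ∀ a b : Bool, PMF.pure (a && b) false ≤ PMF.pure a false + PMF.pure b false := by
    simp [PMF.pure_apply]
  calc (p.bind fun a => q.bind fun b => PMF.pure (a && b)) false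
      ≤ expect p fun a => expect q fun b => PMF.pure a false + PMF.pure b false :=
        expect_mono p fun a => expect_mono q fun b => h a b
    _ = p.bind PMF.pure false + q.bind PMF.pure false := by
        simp only [expect_add, expect_const, bind_apply_eq_expect]
    _ = p false + q false := by rw [p.bind_pure, q.bind_pure]

theorem exists_map_nat_eq (p : PMF α) : ∃ (q : PMF ℕ) (f : ℕ → α), q.map f = p := by
  obtain ⟨f, hf⟩ := p.support_countable.exists_eq_range p.support_nonempty
  refine ⟨p.map (Function.invFun f), f, ?_⟩
  have hinv : ∀ a ∈ p.support, f (Function.invFun f a) = a := fun a ha =>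
    Function.invFun_eq (hf.subset ha)
  conv_rhs => rw [← p.bind_pure]
  rw [PMF.map_comp]
  ext b
  refine tsum_congr fun a => ?_
  by_cases ha : a ∈ p.support
  · rw [Function.comp_apply, Function.comp_apply, hinv a ha]
  · rw [(p.apply_eq_zero_iff a).2 ha, zero_mul, zero_mul]

/-- The law of a list of `T` independent samples of `p`. -/
noncomputable def iidSamples (p : PMF α) : ℕ → PMF (List α)
  | 0 => PMF.pure []
  | T + 1 => p.bind fun a => (iidSamples p T).map (a :: ·)

theorem expect_iidSamples_prod (p : PMF α) (f : α → ENNReal) (T : ℕ) :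
    (expect (iidSamples p T) fun l => (l.map f).prod) = expect p f ^ T := by
  induction T with
  | zero => simp only [iidSamples, expect_pure, List.map_nil, List.prod_nil, pow_zero]
  | succ T ih =>
    simp only [iidSamples, expect_bind, expect_map, List.map_cons, List.prod_cons,
      expect_const_mul, ih]
    simp only [mul_comm (f _), expect_const_mul, pow_succ]

theorem expect_iidSamples_sum (p : PMF α) (f : α → ENNReal) (T : ℕ) :
    (expect (iidSamples p T) fun l => (l.map f).sum) = T * expect p f := by
  induction T with
  | zero => simp only [iidSamples, expect_pure, List.map_nil, List.sum_nil, Nat.cast_zero, zero_mul]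
  | succ T ih =>
    simp only [iidSamples, expect_bind, expect_map, List.map_cons, List.sum_cons, expect_add,
      expect_const, ih, Nat.cast_succ]
    ring

end Laws

/-! ### Learning by maximum likelihood -/

section Learning

variable {X K : Type*}

/-- The trial of a secret `x` of law `g` on an instance `k` of law `D x`; the trial succeeds with
result `true`. In the schemes `x` is the private key and `k` an extracted key. -/
noncomputable def honestTrial (g : PMF X) (D : X → PMF K) (test : X → K → PMF Bool) : PMF Bool :=
  g.bind fun x => (D x).bind (test x)

/-- The likelihood of the hypothesis `x` if all trials on the instances in `l` are successful. -/
noncomputable def likelihood (test : X → K → PMF Bool) (l : List K) (x : X) : ENNReal :=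
  (l.map fun k => test x k true).prod

/-- A hypothesis of maximal likelihood, the learner's substitute for the secret. -/
noncomputable def maxLikelihood [Finite X] [Nonempty X] (test : X → K → PMF Bool)
    (l : List K) : X :=
  (Finite.exists_max (likelihood test l)).choose

theorem likelihood_le_maxLikelihood [Finite X] [Nonempty X] (test : X → K → PMF Bool)
    (l : List K) (x : X) : likelihood test l x ≤ likelihood test l (maxLikelihood test l) :=
  (Finite.exists_max (likelihood test l)).choose_spec x

/-- The trial in which the secret `x` is replaced by the hypothesis learned from `T` instances of
law `D x`; the learner does not see the instance `k` of the trial. -/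
noncomputable def learnedTrial [Finite X] [Nonempty X] (g : PMF X) (D : X → PMF K)
    (test : X → K → PMF Bool) (T : ℕ) : PMF Bool :=
  g.bind fun x => (D x).bind fun k => (iidSamples (D x) T).bind fun l =>
    test (maxLikelihood test l) k

theorem one_le_prod_apply_true_add_sum_apply_false (t : K → PMF Bool) (l : List K) :
    1 ≤ (l.map fun k => t k true).prod + (l.map fun k => t k false).sum := by
  induction l with
  | nil => simp only [List.map_nil, List.prod_nil, List.sum_nil, add_zero, le_refl]
  | cons k l ih =>
    simp only [List.map_cons, List.prod_cons, List.sum_cons]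
    set P := (l.map fun k => t k true).prod
    set S := (l.map fun k => t k false).sum
    have hP : P ≤ 1 := by
      refine (List.prod_le_pow_card _ 1 ?_).trans_eq (one_pow _)
      simp only [List.mem_map, forall_exists_index, and_imp, forall_apply_eq_imp_iff₂]
      exact fun k _ => (t k).coe_le_one true
    calc 1 ≤ P + S := ih
      _ = t k true * P + t k false * P + S := by
        rw [← add_mul, apply_true_add_apply_false, one_mul]
      _ ≤ t k true * P + t k false * 1 + S := by gcongr
      _ = t k true * P + (t k false + S) := by rw [mul_one, add_assoc]

theorem expect_sum_likelihood_le (p : PMF K) (test : X → K → PMF Bool) {bad : Finset X}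
    {δ : ENNReal} (h : ∀ y ∈ bad, p.bind (test y) true ≤ δ) (T : ℕ) :
    (expect (iidSamples p T) fun l => ∑ y ∈ bad, likelihood test l y) ≤ bad.card * δ ^ T := by
  simp only [likelihood, expect_finset_sum, expect_iidSamples_prod]
  calc ∑ y ∈ bad, p.bind (test y) true ^ T
      ≤ ∑ _y ∈ bad, δ ^ T := Finset.sum_le_sum fun y hy => by gcongr; exact h y hy
    _ = bad.card * δ ^ T := by rw [Finset.sum_const, nsmul_eq_mul]

-- A bad choice means that a bad hypothesis beats `x`, or that `x` itself is unlikely.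
theorem bind_maxLikelihood_apply_false_le [Finite X] [Nonempty X] (p : PMF K)
    (test : X → K → PMF Bool) {bad : Finset X} {ε : ENNReal}
    (h : ∀ y ∉ bad, p.bind (test y) false ≤ ε) (x : X) (l : List K) :
    p.bind (test (maxLikelihood test l)) false ≤
      ε + (∑ y ∈ bad, likelihood test l y + (l.map fun k => test x k false).sum) := by
  by_cases hbad : maxLikelihood test l ∈ bad
  · calc p.bind (test (maxLikelihood test l)) false
      _ ≤ 1 := PMF.coe_le_one _ _
      _ ≤ likelihood test l x + (l.map fun k => test x k false).sum :=
        one_le_prod_apply_true_add_sum_apply_false (test x) l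
      _ ≤ ∑ y ∈ bad, likelihood test l y + (l.map fun k => test x k false).sum := by
        gcongr
        exact (likelihood_le_maxLikelihood test l x).trans
          (Finset.single_le_sum (f := likelihood test l) (fun _ _ => zero_le) hbad)
      _ ≤ _ := le_add_self
  · exact (h _ hbad).trans le_self_add

variable [Fintype X] [Nonempty X]

theorem maxLikelihood_failure_le (p : PMF K) (test : X → K → PMF Bool) (x : X) {ε δ : ENNReal}
    (h : ε + δ = 1) (T : ℕ) :
    (expect (iidSamples p T) fun l => p.bind (test (maxLikelihood test l)) false) ≤
      ε + Fintype.card X * δ ^ T + T * p.bind (test x) false := by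
  classical
  let bad : Finset X := {y | ε < p.bind (test y) false}
  have success_le : ∀ y ∈ bad, p.bind (test y) true ≤ δ := by
    intro y hy
    have hsum := apply_true_add_apply_false (p.bind (test y))
    by_contra! hlt
    exact (h.trans hsum.symm).not_lt
      ((add_comm ε δ).trans_lt (ENNReal.add_lt_add hlt (Finset.mem_filter.1 hy).2))
  have failure_le : ∀ y ∉ bad, p.bind (test y) false ≤ ε := fun y hy =>
    not_lt.1 fun hlt => hy (Finset.mem_filter.2 ⟨Finset.mem_univ _, hlt⟩)
  calc (expect (iidSamples p T) fun l => p.bind (test (maxLikelihood test l)) false)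
      ≤ expect (iidSamples p T) fun l =>
        ε + (∑ y ∈ bad, likelihood test l y + (l.map fun k => test x k false).sum) :=
        expect_mono _ (bind_maxLikelihood_apply_false_le p test failure_le x)
    _ = ε + ((expect (iidSamples p T) fun l => ∑ y ∈ bad, likelihood test l y) +
          T * p.bind (test x) false) := by
        simp only [expect_add, expect_const, expect_iidSamples_sum, bind_apply_eq_expect]
    _ ≤ ε + (bad.card * δ ^ T + T * p.bind (test x) false) := by
        gcongr
        exact expect_sum_likelihood_le p test success_le T
    _ ≤ ε + Fintype.card X * δ ^ T + T * p.bind (test x) false := by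
        rw [add_assoc]
        gcongr
        exact Finset.card_le_univ bad

theorem learnedTrial_false_le (g : PMF X) (D : X → PMF K) (test : X → K → PMF Bool)
    {ε δ : ENNReal} (h : ε + δ = 1) (T : ℕ) :
    learnedTrial g D test T false ≤
      ε + Fintype.card X * δ ^ T + T * honestTrial g D test false := by
  calc learnedTrial g D test T false
      = expect g fun x => expect (iidSamples (D x) T) fun l =>
          (D x).bind (test (maxLikelihood test l)) false := by
        simp only [learnedTrial, PMF.bind_comm (D _), bind_apply_eq_expect]
    _ ≤ expect g fun x => ε + Fintype.card X * δ ^ T + T * (D x).bind (test x) false :=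
        expect_mono g fun x => maxLikelihood_failure_le (D x) test x h T
    _ = ε + Fintype.card X * δ ^ T + T * honestTrial g D test false := by
        rw [expect_add, expect_const, expect_const_mul, honestTrial, bind_apply_eq_expect]

theorem toReal_learnedTrial_false_le (g : PMF X) (D : X → PMF K) (test : X → K → PMF Bool)
    {ε : ℝ} (hε₀ : 0 ≤ ε) (hε₁ : ε ≤ 1) (T : ℕ) :
    (learnedTrial g D test T false).toReal ≤
      ε + Fintype.card X * (1 - ε) ^ T + T * (honestTrial g D test false).toReal := by
  have hδ : 0 ≤ 1 - ε := sub_nonneg.2 hε₁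
  have h : ENNReal.ofReal ε + ENNReal.ofReal (1 - ε) = 1 := by
    rw [← ENNReal.ofReal_add hε₀ hδ, add_sub_cancel, ENNReal.ofReal_one]
  refine ENNReal.toReal_le_of_le_ofReal (by positivity) ?_
  rw [ENNReal.ofReal_add (by positivity) (by positivity),
    ENNReal.ofReal_add hε₀ (by positivity), ENNReal.ofReal_mul (Nat.cast_nonneg _),
    ENNReal.ofReal_mul (Nat.cast_nonneg _), ENNReal.ofReal_pow hδ, ENNReal.ofReal_natCast,
    ENNReal.ofReal_natCast, ENNReal.ofReal_toReal (PMF.apply_ne_top _ _)]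
  exact learnedTrial_false_le g D test h T

end Learning

/-! ### Asymptotics -/

theorem Negligible.tendsto_zero {ν : ℕ → ℝ} (h : Negligible ν) :
    Filter.Tendsto ν Filter.atTop (nhds 0) := by
  simpa only [pow_zero, one_mul] using h 0

theorem Negligible.eventually_mul_le {ν : ℕ → ℝ} (h : Negligible ν) {t : ℕ → ℕ}
    (ht : PolyBounded t) {c : ℝ} (hc : 0 < c) : ∀ᶠ n in Filter.atTop, t n * ν n ≤ c := by
  obtain ⟨P, hP⟩ := ht
  have htends := Negligible.tendsto_zero (h.polynomial_mul (P.map (Nat.castRingHom ℝ)))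
  filter_upwards [htends.abs.eventually (ge_mem_nhds (by simpa using hc))] with n hn
  have hPn : (t n : ℝ) ≤ P.eval n := by exact_mod_cast hP n
  calc (t n : ℝ) * ν n ≤ t n * |ν n| := by gcongr; exact le_abs_self _
    _ ≤ P.eval n * |ν n| := by gcongr
    _ ≤ c := by simpa [abs_mul] using hn

theorem not_negligible_success {G : ℕ → PMF Bool} {a c : ℝ} (hac : a + c < 1)
    (hG : ∀ᶠ n in Filter.atTop, (G n false).toReal ≤ c) :
    ¬ ∃ ν, Negligible ν ∧ ∀ n, (G n true).toReal ≤ a + ν n := by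
  rintro ⟨ν, hν, hle⟩
  have hsmall : ∀ᶠ n in Filter.atTop, ν n < 1 - (a + c) :=
    hν.tendsto_zero.eventually (gt_mem_nhds (sub_pos.2 hac))
  obtain ⟨n, hfail, hνn⟩ := (hG.and hsmall).exists
  have hsucc := hle n
  rw [toReal_apply_true] at hsucc
  linarith

/-- The number of instances from which a secret of `p` bits is learned. As `(7 / 8) ^ 6 ≤ 1 / 2`,
the union bound over the `2 ^ p` hypotheses then costs at most `2 ^ (-4)`. -/
def sampleCount (p : ℕ) : ℕ := 6 * (p + 4)

theorem PolyBounded.sampleCount {p : ℕ → ℕ} (hp : PolyBounded p) :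
    PolyBounded fun n => sampleCount (p n) := by
  obtain ⟨P, hP⟩ := hp
  refine ⟨6 * (P + 4), fun n => ?_⟩
  simp only [_root_.sampleCount, Polynomial.eval_mul, Polynomial.eval_add, Polynomial.eval_ofNat]
  gcongr
  exact hP n

theorem two_pow_mul_pow_sampleCount_le (p : ℕ) :
    (2 : ℝ) ^ p * (1 - 1 / 8) ^ sampleCount p ≤ 1 / 16 := by
  calc (2 : ℝ) ^ p * (1 - 1 / 8) ^ sampleCount p
      = 2 ^ p * ((1 - 1 / 8) ^ 6) ^ (p + 4) := by rw [sampleCount, pow_mul]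
    _ ≤ 2 ^ p * (1 / 2) ^ (p + 4) := by
        gcongr
        norm_num
    _ = (2 * (1 / 2)) ^ p * (1 / 2) ^ 4 := by rw [mul_pow, pow_add, mul_assoc]
    _ = 1 / 16 := by norm_num

theorem eventually_learnedTrial_le {X K : ℕ → Type*} [∀ n, Fintype (X n)] [∀ n, Nonempty (X n)]
    {p : ℕ → ℕ} (hp : PolyBounded p) (hX : ∀ n, Fintype.card (X n) ≤ 2 ^ p n)
    {g : ∀ n, PMF (X n)} {D : ∀ n, X n → PMF (K n)} {test : ∀ n, X n → K n → PMF Bool}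
    (h : ∃ ν, Negligible ν ∧ ∀ n, (honestTrial (g n) (D n) (test n) false).toReal ≤ ν n) :
    ∀ᶠ n in Filter.atTop,
      (learnedTrial (g n) (D n) (test n) (sampleCount (p n)) false).toReal ≤ 1 / 4 := by
  obtain ⟨ν, hν, hle⟩ := h
  filter_upwards [hν.eventually_mul_le hp.sampleCount (c := 1 / 16) (by norm_num)] with n hn
  have hcard : (Fintype.card (X n) : ℝ) ≤ 2 ^ p n := by exact_mod_cast hX n
  set T := sampleCount (p n)
  calc (learnedTrial (g n) (D n) (test n) T false).toReal
      ≤ 1 / 8 + Fintype.card (X n) * (1 - 1 / 8) ^ T +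
          T * (honestTrial (g n) (D n) (test n) false).toReal :=
        toReal_learnedTrial_false_le _ _ _ (by norm_num) (by norm_num) T
    _ ≤ 1 / 8 + 2 ^ p n * (1 - 1 / 8) ^ T + T * ν n := by
        gcongr
        exact hle n
    _ ≤ 1 / 8 + 1 / 16 + 1 / 16 := by
        gcongr
        exact two_pow_mul_pow_sampleCount_le _
    _ = 1 / 4 := by norm_num


/-! ### Programs -/

namespace Prog

variable {Q : Type} {A : Q → Type} {α β K : Type}

/-- Sequential composition of programs. -/
def bind : Prog Q A α → (α → Prog Q A β) → Prog Q A β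
  | .ret a, f => f a
  | .coin p next, f => .coin p fun i => (next i).bind f
  | .ask q next, f => .ask q fun a => (next a).bind f

theorem eval_bind (oracle : ∀ q, PMF (A q)) (P : Prog Q A α) (f : α → Prog Q A β) :
    (P.bind f).eval oracle = (P.eval oracle).bind fun a => (f a).eval oracle := by
  induction P with
  | ret a => simp only [bind, eval, PMF.pure_bind]
  | coin p next ih => simp only [bind, eval, PMF.bind_bind, ih]
  | ask q next ih => simp only [bind, eval, PMF.bind_bind, ih]

theorem CostLE.mono {w : Q → ℕ} {P : Prog Q A α} {s t : ℕ} (hP : P.CostLE w s) (hst : s ≤ t) :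
    P.CostLE w t := by
  induction P generalizing s t with
  | ret a => trivial
  | coin p next ih => exact fun i => ih i (hP i) hst
  | ask q next ih => exact ⟨hP.1.trans hst, fun a => ih a (hP.2 a) (Nat.sub_le_sub_right hst _)⟩

theorem CostLE.bind {w : Q → ℕ} {P : Prog Q A α} {f : α → Prog Q A β} {s t : ℕ}
    (hP : P.CostLE w s) (hf : ∀ a, (f a).CostLE w t) : (P.bind f).CostLE w (s + t) := by
  induction P generalizing s with
  | ret a => exact (hf a).mono (Nat.le_add_left t s)
  | coin p next ih => exact fun i => ih i (hP i)
  | ask q next ih =>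
    refine ⟨hP.1.trans (Nat.le_add_right s t), fun a => ?_⟩
    rw [Nat.sub_add_comm hP.1]
    exact ih a (hP.2 a)

theorem CostLE.bind_ret {w : Q → ℕ} {P : Prog Q A α} {t : ℕ} (hP : P.CostLE w t) (f : α → β) :
    (P.bind fun a => .ret (f a)).CostLE w t :=
  hP.bind (t := 0) fun _ => trivial

/-- The program that draws from a given law, which may be on any type: its support is countable,
so natural numbers suffice as coin tosses. -/
noncomputable def sample (p : PMF α) : Prog Q A α :=
  .coin (exists_map_nat_eq p).choose fun i => .ret ((exists_map_nat_eq p).choose_spec.choose i)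

theorem eval_sample (oracle : ∀ q, PMF (A q)) (p : PMF α) : (sample p).eval oracle = p :=
  (exists_map_nat_eq p).choose_spec.choose_spec

theorem costLE_sample (w : Q → ℕ) (p : PMF α) : (sample p : Prog Q A α).CostLE w 0 :=
  fun _ => trivial

/-- The program that asks the same query `T` times and decodes the answers. -/
def collect (q : Q) (decode : A q → K) : ℕ → Prog Q A (List K)
  | 0 => .ret []
  | T + 1 => .ask q fun a => (collect q decode T).bind fun l => .ret (decode a :: l)

theorem eval_collect (oracle : ∀ q, PMF (A q)) (q : Q) (decode : A q → K) (T : ℕ) :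
    (collect q decode T).eval oracle = iidSamples ((oracle q).map decode) T := by
  induction T with
  | zero => rfl
  | succ T ih =>
    simp only [collect, eval, eval_bind, ih, iidSamples, PMF.bind_map, Function.comp_def]
    rfl

theorem costLE_collect (w : Q → ℕ) (q : Q) (decode : A q → K) (T : ℕ) :
    (collect q decode T).CostLE w (T * w q) := by
  induction T with
  | zero => trivial
  | succ T ih =>
    rw [Nat.succ_mul]
    refine ⟨Nat.le_add_left _ _, fun a => ?_⟩
    rw [Nat.add_sub_cancel]
    exact ih.bind_ret _

/-- The program that learns a hypothesis of maximal likelihood from `T` instances, obtained by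
asking the query `q` and decoding the answers. -/
noncomputable def learn {X : Type} [Finite X] [Nonempty X] (q : Q) (decode : A q → K)
    (test : X → K → PMF Bool) (T : ℕ) : Prog Q A X :=
  (collect q decode T).bind fun l => .ret (maxLikelihood test l)

theorem eval_learn {X : Type} [Finite X] [Nonempty X] (oracle : ∀ q, PMF (A q)) (q : Q)
    (decode : A q → K) (test : X → K → PMF Bool) (T : ℕ) :
    (learn q decode test T).eval oracle =
      (iidSamples ((oracle q).map decode) T).map (maxLikelihood test) := by
  rw [learn, eval_bind, eval_collect]
  rfl

theorem costLE_learn {X : Type} [Finite X] [Nonempty X] (w : Q → ℕ) (q : Q) (decode : A q → K)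
    (test : X → K → PMF Bool) (T : ℕ) : (learn q decode test T).CostLE w (T * w q) :=
  (costLE_collect w q decode T).bind_ret _

end Prog

/-! ### Receivers -/

/-- The measurement with a single outcome, which extracts nothing. -/
def POVM.trivial (d : ℕ) : POVM d (Fin 1) where
  effect _ := 1
  posSemidef _ := .one
  sum_eq_one := Fintype.sum_unique _

namespace Receiver

variable {α β : Type}

/-- The receiver that postprocesses the law of its result. For `φ = PMF.map f` this is
postprocessing of the result, but the law itself is also classical knowledge of the receiver. -/
def mapLaw (φ : PMF α → PMF β) : {ds : List ℕ} → Receiver α ds → Receiver β ds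
  | [], R => φ R
  | _ :: _, ⟨m, E, next⟩ => ⟨m, E, fun i => (next i).mapLaw φ⟩

theorem run_mapLaw_map (f : α → β) {ds : List ℕ} (R : Receiver α ds) (σ : Signal ds) :
    (R.mapLaw (PMF.map f)).run σ = (R.run σ).map f := by
  induction ds with
  | nil => rfl
  | cons d ds ih =>
    obtain ⟨m, E, next⟩ := R
    obtain ⟨ρ, σ⟩ := σ
    simp only [mapLaw, run, ih, PMF.map_bind]

theorem run_mapLaw_pure_comp {γ : Type} (g : β → γ) (f : PMF α → β) {ds : List ℕ}
    (R : Receiver α ds) (σ : Signal ds) :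
    (R.mapLaw (PMF.pure ∘ g ∘ f)).run σ = ((R.mapLaw (PMF.pure ∘ f)).run σ).map g := by
  induction ds with
  | nil => exact (PMF.pure_map g (f R)).symm
  | cons d ds ih =>
    obtain ⟨m, E, next⟩ := R
    obtain ⟨ρ, σ⟩ := σ
    simp only [mapLaw, run, ih, PMF.map_bind]

theorem run_mapLaw_apply_add_le {φ : PMF α → PMF β} {a : α} {b : β} {c c' : ENNReal}
    (h : ∀ p, φ p b + c * p a ≤ c') {ds : List ℕ} (R : Receiver α ds) (σ : Signal ds) :
    (R.mapLaw φ).run σ b + c * R.run σ a ≤ c' := by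
  induction ds with
  | nil => exact h R
  | cons d ds ih =>
    obtain ⟨m, E, next⟩ := R
    obtain ⟨ρ, σ⟩ := σ
    simp only [mapLaw, run, bind_apply_eq_expect, ← expect_const_mul, ← expect_add]
    calc (expect (E.measure ρ) fun i => ((next i).mapLaw φ).run σ b + c * (next i).run σ a)
        ≤ expect (E.measure ρ) fun _ => c' := expect_mono _ fun i => ih (next i) σ
      _ = c' := expect_const _ _

/-- The receiver that ignores the transmission and draws its result from `p`. -/
def ignore (p : PMF α) : (ds : List ℕ) → Receiver α ds
  | [] => p
  | d :: ds => ⟨1, .trivial d, fun _ => ignore p ds⟩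

/-- The receiver that ignores the transmission and outputs the first bit of the classical message
which it gets afterwards. -/
noncomputable def echo (ds : List ℕ) : Receiver (Bits → PMF Bool) ds :=
  ignore (PMF.pure fun x => PMF.pure (x.headD false)) ds

end Receiver

/-- The key of length `m` encoded by a bit string; missing bits count as `false`. -/
def keyOfBits {m : ℕ} (l : Bits) : Fin m → Bool := fun i => l.getD i false

theorem keyOfBits_ofFn {m : ℕ} (k : Fin m → Bool) : keyOfBits (List.ofFn k) = k := by
  funext i
  rw [keyOfBits, List.getD_eq_getElem _ _ (by rw [List.length_ofFn]; exact i.2),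
    List.getElem_ofFn]

theorem map_keyOfBits_bind_run_mapLaw_ofFn {m : ℕ} {ds : List ℕ} (p : PMF (Signal ds))
    (R : Receiver (Fin m → Bool) ds) :
    (p.bind (R.mapLaw (PMF.map List.ofFn)).run).map keyOfBits = p.bind R.run := by
  have h : keyOfBits ∘ List.ofFn = (id : (Fin m → Bool) → _) := funext keyOfBits_ofFn
  simp only [Receiver.run_mapLaw_map, PMF.map_bind, PMF.map_comp, h, PMF.map_id]

/-! ### Splitters -/

namespace POVM

variable {d m : ℕ}

/-- The Kraus operators of a measurement seen as an instrument with two empty output registers: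
the rows of square roots of the effects. -/
noncomputable def kraus (E : POVM d (Fin m)) (i : Fin m) (k : Fin (Fintype.card (Qubits d))) :
    Matrix (Qubits 0 × Qubits 0) (Qubits d) ℂ :=
  (CFC.sqrt (E.effect i)).submatrix (fun _ => (Fintype.equivFin (Qubits d)).symm k) id

theorem sum_conjTranspose_kraus_mul_kraus (E : POVM d (Fin m)) (i : Fin m) :
    ∑ k, (E.kraus i k)ᴴ * E.kraus i k = E.effect i := by
  set B := CFC.sqrt (E.effect i) with hB
  have sqrt_mul_sqrt : Bᴴ * B = E.effect i := by
    rw [(Matrix.nonneg_iff_posSemidef.1 (CFC.sqrt_nonneg _)).isHermitian.eq,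
      CFC.sqrt_mul_sqrt_self _ (E.posSemidef i).nonneg]
  rw [← sqrt_mul_sqrt]
  ext y z
  simp only [kraus, ← hB, Matrix.sum_apply, Matrix.mul_apply, Matrix.conjTranspose_apply,
    Matrix.submatrix_apply, id_eq, Fintype.sum_prod_type, Fintype.sum_unique]
  exact (Fintype.equivFin (Qubits d)).symm.sum_comp fun x => star (B x y) * B x z

/-- A measurement as an instrument that sends nothing: the two output registers are empty. -/
noncomputable def toSplitOp (E : POVM d (Fin m)) : SplitOp d 0 0 m (Fintype.card (Qubits d)) where
  kraus := E.kraus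
  sum_eq_one := by simp only [sum_conjTranspose_kraus_mul_kraus, E.sum_eq_one]

theorem map_fst_measure_join_toSplitOp (E : POVM d (Fin m)) (ρ : Density d) :
    ((E.toSplitOp.join (trivial 0) (trivial 0)).measure ρ).map Prod.fst = E.measure ρ := by
  classical
  have effect_join : ∀ x, (E.toSplitOp.join (trivial 0) (trivial 0)).effect x = E.effect x.1 := by
    simp only [SplitOp.join, trivial, Matrix.one_kronecker_one, Matrix.mul_one, toSplitOp,
      sum_conjTranspose_kraus_mul_kraus, implies_true]
  ext i
  simp only [PMF.map_apply, measure, PMF.ofFintype_apply, effect_join, tsum_fintype,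
    Fintype.sum_prod_type, Fintype.sum_unique, Finset.sum_ite_eq, Finset.mem_univ, if_true]

end POVM

namespace Receiver

variable {α β γ δ : Type}

/-- A receiver as a splitter that sends nothing. A splitter has a deterministic result, so the
result is a function of the law from which the receiver would have drawn its own. -/
noncomputable def toSplitter (f : PMF α → β) :
    {ds : List ℕ} → Receiver α ds → Splitter β 0 0 ds
  | [], R => f R
  | _ :: _, ⟨m, E, next⟩ => ⟨m, _, E.toSplitOp, fun i => (next i).toSplitter f⟩

theorem run_toSplitter_ignore (f : PMF α → β) (p : PMF γ) (q : PMF δ) {ds : List ℕ}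
    (R : Receiver α ds) (σ : Signal ds) :
    (R.toSplitter f).run (ignore p _) (ignore q _) σ =
      ((R.mapLaw (PMF.pure ∘ f)).run σ).bind fun b => p.bind fun c => q.map fun d => (b, c, d) := by
  induction ds with
  | nil =>
    exact (PMF.pure_bind (f R) fun b => p.bind fun c => q.map fun d => (b, c, d)).symm
  | cons d ds ih =>
    obtain ⟨m, E, next⟩ := R
    obtain ⟨ρ, σ⟩ := σ
    calc (toSplitter f (ds := d :: ds) ⟨m, E, next⟩).run (ignore p _) (ignore q _) (ρ, σ)
        = ((E.toSplitOp.join (.trivial 0) (.trivial 0)).measure ρ).bind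
            ((fun i => ((next i).toSplitter f).run (ignore p _) (ignore q _) σ) ∘ Prod.fst) := rfl
      _ = (E.measure ρ).bind
            fun i => ((next i).toSplitter f).run (ignore p _) (ignore q _) σ := by
        rw [← PMF.bind_map, POVM.map_fst_measure_join_toSplitOp]
      _ = _ := by simp only [ih, mapLaw, run, PMF.bind_bind]

end Receiver

/-! ### Attacks on encryption schemes -/

section MoreLikely

variable {M : Type*}

/-- The bit `b` for which `μ_b` is the more likely outcome of `p`. -/
noncomputable def moreLikely (μ₀ μ₁ : M) (p : PMF M) : Bool := decide (p μ₀ ≤ p μ₁)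

theorem pure_moreLikely_apply_add_le {μ₀ μ₁ : M} (h : μ₀ ≠ μ₁) (b : Bool) (p : PMF M) :
    PMF.pure (moreLikely μ₀ μ₁ p) (!b) + 2 * p (if b then μ₁ else μ₀) ≤ 2 := by
  have hsum : p μ₀ + p μ₁ ≤ 1 := apply_add_apply_le_one p h
  rcases Bool.eq_or_eq_not (moreLikely μ₀ μ₁ p) b with hb | hb
  · rw [hb, PMF.pure_apply_of_ne _ _ b.not_ne_self, zero_add]
    exact mul_le_of_le_one_right' (p.coe_le_one _)
  · have hle : p (if b then μ₁ else μ₀) ≤ p (if b then μ₀ else μ₁) := by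
      cases b <;> simp_all [moreLikely, le_of_lt]
    have hsum' : p (if b then μ₀ else μ₁) + p (if b then μ₁ else μ₀) ≤ 1 := by
      cases b <;> simpa [add_comm] using hsum
    calc PMF.pure (moreLikely μ₀ μ₁ p) (!b) + 2 * p (if b then μ₁ else μ₀)
        = 1 + (p (if b then μ₁ else μ₀) + p (if b then μ₁ else μ₀)) := by
          rw [hb, PMF.pure_apply_self, two_mul]
      _ ≤ 1 + (p (if b then μ₀ else μ₁) + p (if b then μ₁ else μ₀)) := by gcongr
      _ ≤ 1 + 1 := by gcongr
      _ = 2 := one_add_one_eq_two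

end MoreLikely

namespace EncScheme

variable {Msg : ℕ → Type} (S : EncScheme Msg) (n : ℕ)

/-- The law of a key extracted by an honest user from one copy of the public key. -/
noncomputable def extract (sk : S.SK n) : PMF (S.Key n) :=
  (S.keySend n sk).bind (S.keyReceive n).run

theorem decryption_eq (μ : Msg n) : S.decryption n μ =
    (S.gen n).bind fun sk => (S.extract n sk).bind fun k =>
      (S.enc n k μ).bind (S.dec n sk).run := by
  simp only [decryption, setup, extract, bind, pure, PMF.bind_bind, PMF.pure_bind]

/-- The oracle query by which an adversary extracts a key like an honest user. -/
noncomputable def extractQuery : S.Query n :=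
  .key ((S.keyReceive n).mapLaw (PMF.map List.ofFn))

/-- The program that learns a substitute for the private key from extracted keys. -/
noncomputable def learner (test : S.SK n → S.Key n → PMF Bool) : S.Attack n (S.SK n) :=
  .learn (S.extractQuery n) keyOfBits test (sampleCount (S.skLen n))

theorem eval_learner (test : S.SK n → S.Key n → PMF Bool) (sk : S.SK n) (k : S.Key n) :
    (S.learner n test).eval (S.oracle n sk k) =
      (iidSamples (S.extract n sk) (sampleCount (S.skLen n))).map (maxLikelihood test) := by
  have hdecode : PMF.map keyOfBits (S.oracle n sk k (S.extractQuery n)) = S.extract n sk :=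
    map_keyOfBits_bind_run_mapLaw_ofFn _ _
  rw [← hdecode]
  exact Prog.eval_learn _ _ _ _ _

theorem costLE_learner (test : S.SK n → S.Key n → PMF Bool) (w : S.Query n → ℕ) :
    (S.learner n test).CostLE w (sampleCount (S.skLen n) * w (S.extractQuery n)) :=
  Prog.costLE_learn _ _ _ _ _

variable (μ₀ μ₁ : Msg n)

/-- Decryption with the key `sk`, rounded to the bit `b` of the more likely message `μ_b`. The
rounding makes the result deterministic given the measurement outcomes, so that two parties can
output it simultaneously. -/
noncomputable def guess (sk : S.SK n) : Receiver Bool (S.ctFmt n) :=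
  (S.dec n sk).mapLaw (PMF.pure ∘ moreLikely μ₀ μ₁)

/-- The splitter that keeps the guess obtained with the key `sk` and sends nothing. -/
noncomputable def guessSplitter (sk : S.SK n) : Splitter Bits 0 0 (S.ctFmt n) :=
  (S.dec n sk).toSplitter (([·]) ∘ moreLikely μ₀ μ₁)

theorem run_guessSplitter_echo (sk : S.SK n) (σ : Signal (S.ctFmt n)) :
    (S.guessSplitter n μ₀ μ₁ sk).run (.echo _) (.echo _) σ =
      ((S.guess n μ₀ μ₁ sk).run σ).map fun b =>
        ([b], fun x => PMF.pure (x.headD false), fun x => PMF.pure (x.headD false)) := by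
  simp only [guessSplitter, Receiver.echo, Receiver.run_toSplitter_ignore,
    Receiver.run_mapLaw_pure_comp, PMF.pure_map, PMF.pure_bind, PMF.bind_map]
  rfl

/-- The trial that succeeds if the key `sk` serves to guess which message is encrypted. -/
noncomputable def guessTest (sk : S.SK n) (k : S.Key n) : PMF Bool :=
  fairCoin.bind fun b => (S.enc n k (if b then μ₁ else μ₀)).bind fun ρ =>
    ((S.guess n μ₀ μ₁ sk).run ρ).map (· == b)

theorem bind_map_guess_apply_false_add_le (h : μ₀ ≠ μ₁) (b : Bool) (p : PMF (Signal (S.ctFmt n)))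
    (sk : S.SK n) :
    (p.bind fun ρ => ((S.guess n μ₀ μ₁ sk).run ρ).map (· == b)) false +
      2 * p.bind (S.dec n sk).run (if b then μ₁ else μ₀) ≤ 2 := by
  simp only [bind_apply_eq_expect p, ← expect_const_mul, ← expect_add, map_beq_apply_false]
  refine (expect_mono _ fun ρ => ?_).trans_eq (expect_const _ _)
  exact Receiver.run_mapLaw_apply_add_le (pure_moreLikely_apply_add_le h b) _ ρ

theorem guessTest_apply_false_add_le (h : μ₀ ≠ μ₁) (sk : S.SK n) (k : S.Key n) :
    S.guessTest n μ₀ μ₁ sk k false + ((S.enc n k μ₀).bind (S.dec n sk).run μ₀ +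
      (S.enc n k μ₁).bind (S.dec n sk).run μ₁) ≤ 2 := by
  have hbit := fun b => S.bind_map_guess_apply_false_add_le n _ _ h b
    (S.enc n k (if b then μ₁ else μ₀)) sk
  rw [← ENNReal.mul_le_mul_iff_right two_ne_zero ENNReal.ofNat_ne_top, mul_add, mul_add, guessTest,
    bind_apply_eq_expect, expect_fairCoin, add_comm (2 * _), add_add_add_comm]
  exact (add_le_add (hbit true) (hbit false)).trans_eq (two_mul _).symm

theorem honestTrial_guessTest_apply_false_add_le (h : μ₀ ≠ μ₁) :
    honestTrial (S.gen n) (S.extract n) (S.guessTest n μ₀ μ₁) false +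
      (S.decryption n μ₀ μ₀ + S.decryption n μ₁ μ₁) ≤ 2 := by
  simp only [honestTrial, decryption_eq, bind_apply_eq_expect (S.gen n),
    bind_apply_eq_expect (S.extract n _), ← expect_add]
  calc _ ≤ expect (S.gen n) fun sk => expect (S.extract n sk) fun _ => 2 :=
        expect_mono _ fun sk => expect_mono _ fun k => S.guessTest_apply_false_add_le n _ _ h sk k
    _ = 2 := by simp only [expect_const]

theorem learnedTrial_guessTest :
    learnedTrial (S.gen n) (S.extract n) (S.guessTest n μ₀ μ₁) (sampleCount (S.skLen n)) =
      (S.setup n).bind fun x => fairCoin.bind fun b =>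
        ((S.learner n (S.guessTest n μ₀ μ₁)).eval (S.oracle n x.1 x.2)).bind fun sk =>
          (S.enc n x.2 (if b then μ₁ else μ₀)).bind fun ρ =>
            ((S.guess n μ₀ μ₁ sk).run ρ).map (· == b) := by
  simp only [learnedTrial, setup, eval_learner, bind, pure, PMF.bind_bind, PMF.pure_bind,
    PMF.bind_map, Function.comp_def]
  simp only [PMF.bind_comm fairCoin]
  simp only [guessTest, extract, PMF.bind_bind]

/-- Guess with the learned key, having seen copies of the public key only. -/
noncomputable def keyOnlyAttack : S.Attack n (Receiver Bool (S.ctFmt n)) :=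
  (S.learner n (S.guessTest n μ₀ μ₁)).bind fun sk => .ret (S.guess n μ₀ μ₁ sk)

theorem keyOnlyExp_keyOnlyAttack : S.keyOnlyExp n μ₀ μ₁ (S.keyOnlyAttack n μ₀ μ₁) =
    learnedTrial (S.gen n) (S.extract n) (S.guessTest n μ₀ μ₁) (sampleCount (S.skLen n)) := by
  simp only [learnedTrial_guessTest, keyOnlyExp, keyOnlyAttack, Prog.eval_bind, Prog.eval, bind,
    pure, PMF.bind_bind, PMF.pure_bind]
  rfl

variable (μ₀ μ₁ : ∀ n, Msg n)

/-- The key-only attack in the form of a chosen ciphertext attack: the ciphertext is reduced to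
the guess before the private key is revealed. -/
noncomputable def disAttack : S.DisAdversary where
  choose n := (S.learner n (S.guessTest n (μ₀ n) (μ₁ n))).bind fun sk =>
    .ret (μ₀ n, μ₁ n, (S.guess n (μ₀ n) (μ₁ n) sk).mapLaw (PMF.map fun b => [b]))
  guess _ x _ := .ret (x.headD false)

theorem disExp_disAttack : S.disExp (S.disAttack μ₀ μ₁) n =
    learnedTrial (S.gen n) (S.extract n) (S.guessTest n (μ₀ n) (μ₁ n))
      (sampleCount (S.skLen n)) := by
  simp only [learnedTrial_guessTest, disExp, disAttack, Prog.eval_bind, Prog.eval, bind,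
    pure, PMF.bind_bind, PMF.pure_bind, Receiver.run_mapLaw_map, PMF.bind_map,
    Function.comp_def, List.headD_cons]
  rfl

/-- The key-only attack in the form of a cloning attack: the splitter measures the ciphertext, and
the two parties output the guess that they are told in the end. -/
noncomputable def uncAttack : S.UncAdversary where
  f₁ _ := 0
  f₂ _ := 0
  choose n := (S.learner n (S.guessTest n (μ₀ n) (μ₁ n))).bind fun sk =>
    .ret (μ₀ n, μ₁ n, S.guessSplitter n (μ₀ n) (μ₁ n) sk)
  finish _ x := .ret (x, x)
  fst _ _ := .echo _
  snd _ _ := .echo _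

theorem uncExp_uncAttack : S.uncExp (S.uncAttack μ₀ μ₁) n =
    learnedTrial (S.gen n) (S.extract n) (S.guessTest n (μ₀ n) (μ₁ n))
      (sampleCount (S.skLen n)) := by
  simp only [learnedTrial_guessTest, uncExp, uncAttack, Prog.eval_bind, Prog.eval, bind, pure,
    PMF.bind_bind, PMF.pure_bind, run_guessSplitter_echo, PMF.bind_map, Function.comp_def,
    List.headD_cons, Bool.and_self]
  rfl

variable {S μ₀ μ₁}

theorem Correct.exists_honestTrial_guessTest_le (hS : S.Correct) (h : ∀ n, μ₀ n ≠ μ₁ n) :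
    ∃ ν, Negligible ν ∧ ∀ n, (honestTrial (S.gen n) (S.extract n)
      (S.guessTest n (μ₀ n) (μ₁ n)) false).toReal ≤ ν n := by
  obtain ⟨ν₀, hν₀, h₀⟩ := hS μ₀
  obtain ⟨ν₁, hν₁, h₁⟩ := hS μ₁
  refine ⟨ν₀ + ν₁, hν₀.add hν₁, fun n => ?_⟩
  have htop : S.decryption n (μ₀ n) (μ₀ n) + S.decryption n (μ₁ n) (μ₁ n) ≠ ⊤ :=
    ENNReal.add_ne_top.2 ⟨PMF.apply_ne_top _ _, PMF.apply_ne_top _ _⟩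
  have hle := ENNReal.toReal_mono ENNReal.ofNat_ne_top
    (S.honestTrial_guessTest_apply_false_add_le n _ _ (h n))
  rw [ENNReal.toReal_add (PMF.apply_ne_top _ _) htop, ENNReal.toReal_add (PMF.apply_ne_top _ _)
    (PMF.apply_ne_top _ _), ENNReal.toReal_ofNat] at hle
  rw [Pi.add_apply]
  linarith [h₀ n, h₁ n]

theorem Correct.not_negligible_guess (hS : S.Correct) (h : ∀ n, μ₀ n ≠ μ₁ n) :
    ¬ ∃ ν, Negligible ν ∧ ∀ n, (learnedTrial (S.gen n) (S.extract n)
      (S.guessTest n (μ₀ n) (μ₁ n)) (sampleCount (S.skLen n)) true).toReal ≤ 1 / 2 + ν n :=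
  not_negligible_success (by norm_num) (eventually_learnedTrial_le S.skLen_poly
    (fun n => by simp) (hS.exists_honestTrial_guessTest_le h))

theorem Correct.not_keyOnlyIndist (hS : S.Correct) (h : ∀ n, μ₀ n ≠ μ₁ n) :
    ¬ S.KeyOnlyIndist μ₀ μ₁ := by
  intro hsec
  refine hS.not_negligible_guess h ?_
  simp only [← keyOnlyExp_keyOnlyAttack]
  exact hsec _
    ⟨_, S.skLen_poly.sampleCount, fun n =>
      ((S.costLE_learner n _ _).bind_ret _).mono (mul_one _).le⟩
    fun n => (S.costLE_learner n _ _).bind_ret _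

theorem Correct.not_QDCCA1 (hS : S.Correct) (h : ∀ n, μ₀ n ≠ μ₁ n) : ¬ S.QDCCA1 := by
  intro hsec
  refine hS.not_negligible_guess h ?_
  simp only [← disExp_disAttack]
  exact hsec _ ⟨_, S.skLen_poly.sampleCount, fun n =>
    ⟨((S.costLE_learner n _ _).bind_ret _).mono (mul_one _).le, fun _ _ => ⟨trivial, trivial⟩⟩⟩

theorem Correct.not_QUCCA (hS : S.Correct) (h : ∀ n, μ₀ n ≠ μ₁ n) : ¬ S.QUCCA := by
  intro hsec
  refine hS.not_negligible_guess h ?_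
  simp only [← uncExp_uncAttack]
  exact hsec _ ⟨_, S.skLen_poly.sampleCount, fun n =>
    ⟨((S.costLE_learner n _ _).bind_ret _).mono (mul_one _).le, fun _ => ⟨trivial, trivial⟩⟩⟩

end EncScheme

/-! ### Attacks on signature schemes -/

namespace SigScheme

variable {Msg : ℕ → Type} (S : SigScheme Msg) (n : ℕ)

/-- The law of a key extracted by an honest user from one copy of the public key. -/
noncomputable def extract (sk : S.SK n) : PMF (S.Key n) :=
  (S.keySend n sk).bind (S.keyReceive n).run

/-- The oracle query by which an adversary extracts a key like an honest user. -/
noncomputable def extractQuery : S.Query n :=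
  .key ((S.keyReceive n).mapLaw (PMF.map List.ofFn))

/-- The program that learns a substitute for the private key from extracted keys. -/
noncomputable def learner (test : S.SK n → S.Key n → PMF Bool) : S.Attack n (S.SK n) :=
  .learn (S.extractQuery n) keyOfBits test (sampleCount (S.skLen n))

theorem eval_learner (test : S.SK n → S.Key n → PMF Bool) (sk : S.SK n) (k : S.Key n) :
    (S.learner n test).eval (S.oracle n sk k) =
      (iidSamples (S.extract n sk) (sampleCount (S.skLen n))).map (maxLikelihood test) := by
  have hdecode : PMF.map keyOfBits (S.oracle n sk k (S.extractQuery n)) = S.extract n sk :=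
    map_keyOfBits_bind_run_mapLaw_ofFn _ _
  rw [← hdecode]
  exact Prog.eval_learn _ _ _ _ _

theorem costLE_learner (test : S.SK n → S.Key n → PMF Bool) (w : S.Query n → ℕ) :
    (S.learner n test).CostLE w (sampleCount (S.skLen n) * w (S.extractQuery n)) :=
  Prog.costLE_learn _ _ _ _ _

section Attacks

variable (μ : Msg n)

/-- The trial that succeeds if a signature made with the key `sk` is accepted. -/
noncomputable def signTest (sk : S.SK n) (k : S.Key n) : PMF Bool :=
  (S.sign n sk μ).bind (S.verify n k μ).run

theorem honestTrial_signTest :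
    honestTrial (S.gen n) (S.extract n) (S.signTest n μ) = S.verification n μ := by
  simp only [honestTrial, extract, verification, setup, bind, pure, PMF.bind_bind, PMF.pure_bind]
  rfl

/-- Sign with the learned key, having seen copies of the public key only. -/
noncomputable def keyOnlyAttack : S.Attack n (Signal (S.sigFmt n)) :=
  (S.learner n (S.signTest n μ)).bind fun sk => .sample (S.sign n sk μ)

theorem costLE_keyOnlyAttack (w : S.Query n → ℕ) :
    (S.keyOnlyAttack n μ).CostLE w (sampleCount (S.skLen n) * w (S.extractQuery n)) :=
  (S.costLE_learner n _ w).bind fun _ => Prog.costLE_sample w _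

theorem keyOnlyExp_keyOnlyAttack : S.keyOnlyExp n μ (S.keyOnlyAttack n μ) =
    learnedTrial (S.gen n) (S.extract n) (S.signTest n μ) (sampleCount (S.skLen n)) := by
  simp only [learnedTrial, extract, signTest, keyOnlyExp, setup, keyOnlyAttack, Prog.eval_bind,
    Prog.eval_sample, eval_learner, bind, pure, PMF.bind_bind, PMF.pure_bind, PMF.bind_map,
    Function.comp_def]

end Attacks

variable (μ : ∀ n, Msg n)

/-- The key-only attack, which does not need the signatures it may ask for. -/
noncomputable def disAttack : S.DisAdversary where
  learn _ := .ret []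
  forge n _ := (S.keyOnlyAttack n (μ n)).bind fun ρ => .ret (μ n, ρ)

theorem disExp_disAttack :
    S.disExp (S.disAttack μ) n = S.keyOnlyExp n (μ n) (S.keyOnlyAttack n (μ n)) := by
  simp only [disExp, keyOnlyExp, disAttack, Prog.eval_bind, Prog.eval, bind, PMF.bind_bind,
    PMF.pure_bind]

/-- The key-only attack, whose forged signature is output twice. -/
noncomputable def uncAttack : S.UncAdversary := fun n =>
  (S.keyOnlyAttack n (μ n)).bind fun ρ => .ret ((μ n, ρ), (μ n, ρ))

theorem uncExp_uncAttack_apply_false_le : S.uncExp (S.uncAttack μ) n false ≤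
    2 * S.keyOnlyExp n (μ n) (S.keyOnlyAttack n (μ n)) false := by
  simp only [uncExp, keyOnlyExp, uncAttack, Prog.eval_bind, Prog.eval, bind, pure, PMF.bind_bind,
    PMF.pure_bind, bind_apply_eq_expect (S.setup n)]
  rw [← expect_const_mul]
  refine expect_mono _ fun x => ?_
  rw [bind_apply_eq_expect, bind_apply_eq_expect, ← expect_const_mul]
  exact expect_mono _ fun ρ => (bind_and_bind_false_le _ _).trans_eq (two_mul _).symm

variable {S μ}

theorem Correct.eventually_keyOnlyExp_keyOnlyAttack_le (hS : S.Correct) (μ : ∀ n, Msg n) :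
    ∀ᶠ n in Filter.atTop,
      (S.keyOnlyExp n (μ n) (S.keyOnlyAttack n (μ n)) false).toReal ≤ 1 / 4 := by
  obtain ⟨ν, hν, hle⟩ := hS μ
  simp only [keyOnlyExp_keyOnlyAttack]
  refine eventually_learnedTrial_le S.skLen_poly (fun n => by simp) ⟨ν, hν, fun n => ?_⟩
  have hsucc := hle n
  rw [toReal_apply_true] at hsucc
  rw [honestTrial_signTest]
  linarith

theorem Correct.not_keyOnlyUnforgeable (hS : S.Correct) (μ : ∀ n, Msg n) :
    ¬ S.KeyOnlyUnforgeable μ := by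
  intro hsec
  refine not_negligible_success (a := 0) (by norm_num)
    (hS.eventually_keyOnlyExp_keyOnlyAttack_le μ) ?_
  simp only [zero_add]
  exact hsec _
    ⟨_, S.skLen_poly.sampleCount, fun n => (S.costLE_keyOnlyAttack n _ _).mono (mul_one _).le⟩
    fun n => S.costLE_keyOnlyAttack n _ _

theorem Correct.not_QDCMVA (hS : S.Correct) (μ : ∀ n, Msg n) : ¬ S.QDCMVA := by
  intro hsec
  refine not_negligible_success (a := 0) (by norm_num)
    (hS.eventually_keyOnlyExp_keyOnlyAttack_le μ) ?_
  simp only [zero_add, ← disExp_disAttack]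
  exact hsec _ ⟨_, S.skLen_poly.sampleCount, fun n => ⟨trivial, fun _ =>
    ⟨((S.costLE_keyOnlyAttack n _ _).bind_ret _).mono (mul_one _).le,
      (S.costLE_keyOnlyAttack n _ _).bind_ret _⟩⟩⟩

theorem Correct.not_QUCVA (hS : S.Correct) (μ : ∀ n, Msg n) : ¬ S.QUCVA := by
  intro hsec
  have hfail : ∀ᶠ n in Filter.atTop, (S.uncExp (S.uncAttack μ) n false).toReal ≤ 1 / 2 := by
    filter_upwards [hS.eventually_keyOnlyExp_keyOnlyAttack_le μ] with n hn
    have hle := ENNReal.toReal_mono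
      (ENNReal.mul_ne_top ENNReal.ofNat_ne_top (PMF.apply_ne_top _ _))
      (S.uncExp_uncAttack_apply_false_le n μ)
    rw [ENNReal.toReal_mul, ENNReal.toReal_ofNat] at hle
    linarith
  refine not_negligible_success (a := 0) (by norm_num) hfail ?_
  simp only [zero_add]
  exact hsec _ ⟨_, S.skLen_poly.sampleCount, fun n =>
    ⟨((S.costLE_keyOnlyAttack n _ _).bind_ret _).mono (mul_one _).le,
      ((S.costLE_keyOnlyAttack n _ _).bind_ret _).mono zero_le_one⟩⟩

end SigScheme

theorem theorem0 :
    (∀ (Msg : ℕ → Type) [∀ n, Nontrivial (Msg n)] (S : EncScheme Msg), S.Correct →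
      (∀ μ₀ μ₁ : ∀ n, Msg n, (∀ n, μ₀ n ≠ μ₁ n) → ¬ S.KeyOnlyIndist μ₀ μ₁) ∧
      ¬ S.QDCCA1 ∧ ¬ S.QUCCA) ∧
    (∀ (Msg : ℕ → Type) [∀ n, Nonempty (Msg n)] (S : SigScheme Msg), S.Correct →
      (∀ μ : ∀ n, Msg n, ¬ S.KeyOnlyUnforgeable μ) ∧
      ¬ S.QDCMVA ∧ ¬ S.QUCVA) := by
  refine ⟨fun Msg _ S hS => ?_, fun Msg _ S hS => ?_⟩
  · choose μ₀ μ₁ h using fun n => exists_pair_ne (Msg n)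
    exact ⟨fun _ _ h' => hS.not_keyOnlyIndist h', hS.not_QDCCA1 h, hS.not_QUCCA h⟩
  · have μ : ∀ n, Msg n := fun n => Classical.arbitrary (Msg n)
    exact ⟨hS.not_keyOnlyUnforgeable, hS.not_QDCMVA μ, hS.not_QUCVA μ⟩
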